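/- \textbf{Setting.} Let $d\in\mathbb N$, $r>0$, $\alpha\in(0,\infty]$, $\mathbb B_d(r)=\{\theta\in\mathbb R^d:\|\theta\|_2\le r\}$, and let $P$ be a probability distribution of a pair $(X,Y)$ with $X\in[0,1]^d$ and $Y\in\{-1,+1\}$. Let $\sigma(z)=1/(1+e^{-z})$ and $g_\theta(x)=\sigma(\langle\theta,x\rangle)$. The $\alpha$-loss of $g_\theta$ at $(x,y)$ is $$l^\alpha(y,g_\theta(x))=\frac{\alpha}{\alpha-1}\Bigl(1-g_\theta(yx)^{1-1/\alpha}\Bigr)\quad(\alpha\ne 1,\infty),\qquad l^1=-\log g_\theta(yx),\qquad l^\infty=1-g_\theta(yx),$$ and the margin-based $\alpha$-loss is $$\tilde l^\alpha(z)=\frac{\alpha}{\alpha-1}\Bigl(1-(1+e^{-z})^{1/\alpha-1}\Bigr)\quad(\alpha\ne 1,\infty),\qquad \tilde l^1(z)=\log(1+e^{-z}),\qquad \tilde l^\infty(z)=(1+e^{z})^{-1}.$$ Put $R_\alpha(\theta)=\mathbb E[l^\alpha(Y,g_\theta(X))]$ for $\theta\in\mathbb B_d(r)$ and $R_\alpha(f)=\mathbb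 E[\tilde l^\alpha(Yf(X))]\in[0,\infty]$ for measurable $f:[0,1]^d\to\mathbb R$. Let $(X_i,Y_i)_{i\ge1}$ be i.i.d. with law $P$, and let $$\hat R_{\alpha,n}(\theta)=\frac1n\sum_{i=1}^n l^\alpha(Y_i,g_\theta(X_i)),\qquad \theta\in\mathbb B_d(r).$$ Let $\operatorname{sign}(t)=+1$ for $t>0$, $\operatorname{sign}(t)=-1$ for $t<0$, and let $\operatorname{sign}(0)\in\{-1,+1\}$ be either of the two values, fixed once and for all. For measurable $f$ let $R(f)=\mathbb P[Y\ne\operatorname{sign}(f(X))]$. \textbf{Theorem.} Assume that the minimum $\alpha$-risk is attained by the logistic model, i.e. both minima below exist and $$\min_{\theta\in\mathbb B_d(r)}R_\alpha(\theta)=\min_{f:[0,1]^d\to\mathbb R\ \text{measurable}}R_\alpha(f).$$ If, for each $n\ge1$, $\hat\theta_n$ is (almost surely) a global minimizer of $\hat R_{\alpha,n}$ over $\mathbb B_d(r)$, then the minimum $R^*=\min_{f:[0,1]^d\to\mathbb R\ \text{measurable}}R(f)$ exists and, almost surely, $$\lim_{n\to\infty}R\bigl(\langle\hat\theta_n,\cdot\rangle\bigr)=R^*.$$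 -/

import Mathlib

open MeasureTheory ProbabilityTheory Filter Topology
open scoped ENNReal

noncomputable section

namespace AlphaLoss

/-- The `α`-loss, `α ∈ (0,∞]`, incurred when probability `p` is given to the true label:
`α/(α-1) * (1 - p^(1-1/α))`, with `-log p` for `α = 1` and `1 - p` for `α = ∞`. -/
def softLoss (α : ℝ≥0∞) (p : ℝ) : ℝ :=
  if α = ∞ then 1 - p
  else if α = 1 then -Real.log p
  else α.toReal / (α.toReal - 1) * (1 - p ^ (1 - 1 / α.toReal))

/-- The margin-based `α`-loss, `α ∈ (0,∞]`, at the margin `z = y * f x`. -/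
def marginLoss (α : ℝ≥0∞) (z : ℝ) : ℝ :=
  if α = ∞ then (1 + Real.exp z)⁻¹
  else if α = 1 then Real.log (1 + Real.exp (-z))
  else α.toReal / (α.toReal - 1) * (1 - (1 + Real.exp (-z)) ^ (1 / α.toReal - 1))

/-- The margin-based loss is the `α`-loss composed with the sigmoid. -/
theorem softLoss_sigmoid (α : ℝ≥0∞) (z : ℝ) :
    softLoss α (Real.sigmoid z) = marginLoss α z := by
  have hpos : 0 < 1 + Real.exp (-z) := by positivity
  unfold softLoss marginLoss
  split_ifs with h1 h2
  · have h := Real.exp_pos z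
    rw [Real.sigmoid_def, Real.exp_neg]
    field_simp
    ring
  · rw [Real.sigmoid_def, Real.log_inv, neg_neg]
  · rw [Real.sigmoid_def, Real.inv_rpow hpos.le, ← Real.rpow_neg hpos.le, neg_sub]

/-- The margin-based loss is nonnegative, so that its expectation is the lower integral of
its image in `[0,∞]`. -/
theorem marginLoss_nonneg (α : ℝ≥0∞) (hα : 0 < α) (z : ℝ) : 0 ≤ marginLoss α z := by
  have hone : 1 ≤ 1 + Real.exp (-z) := by have := Real.exp_pos (-z); linarith
  unfold marginLoss
  split_ifs with h1 h2
  · positivity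
  · exact Real.log_nonneg hone
  · have ha : 0 < α.toReal := ENNReal.toReal_pos hα.ne' h1
    rcases le_total α.toReal 1 with h | h
    · have he : 0 ≤ 1 / α.toReal - 1 := by
        rw [sub_nonneg, le_div_iff₀ ha]; linarith
      have := Real.one_le_rpow hone he
      exact mul_nonneg_of_nonpos_of_nonpos
        (div_nonpos_of_nonneg_of_nonpos ha.le (by linarith)) (by linarith)
    · have he : 1 / α.toReal - 1 ≤ 0 := by
        rw [sub_nonpos, div_le_iff₀ ha]; linarith
      have := Real.rpow_le_one_of_one_le_of_nonpos hone he
      exact mul_nonneg (div_nonneg ha.le (by linarith)) (by linarith)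

variable {d : ℕ}

/-- The soft classifier `g_θ(x) = σ(⟨θ, x⟩)` of the logistic model. -/
def logistic (θ x : EuclideanSpace ℝ (Fin d)) : ℝ := Real.sigmoid (inner ℝ θ x)

/-- `P` is the law of a pair `(X, Y)` with `X ∈ [0,1]^d` and `Y ∈ {-1, 1}`. -/
def IsDataLaw (P : Measure (EuclideanSpace ℝ (Fin d) × ℝ)) : Prop :=
  IsProbabilityMeasure P ∧
    ∀ᵐ p ∂P, (∀ j, p.1 j ∈ Set.Icc (0 : ℝ) 1) ∧ (p.2 = -1 ∨ p.2 = 1)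

/-- The `α`-risk `E[l^α(Y, g_θ(X))]` of the logistic model at `θ`, with `l^α(y, g_θ(x))` given
by the probability `g_θ(y x)` that the model assigns to the label `y ∈ {-1, 1}`. -/
def modelRisk (α : ℝ≥0∞) (P : Measure (EuclideanSpace ℝ (Fin d) × ℝ))
    (θ : EuclideanSpace ℝ (Fin d)) : ℝ≥0∞ :=
  ∫⁻ p, ENNReal.ofReal (softLoss α (logistic θ (p.2 • p.1))) ∂P

/-- The `α`-risk `E[marginLoss α (Y f(X))]` of a classification function `f`. -/
def functionRisk (α : ℝ≥0∞) (P : Measure (EuclideanSpace ℝ (Fin d) × ℝ))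
    (f : EuclideanSpace ℝ (Fin d) → ℝ) : ℝ≥0∞ :=
  ∫⁻ p, ENNReal.ofReal (marginLoss α (p.2 * f p.1)) ∂P

/-- The minimum of the `α`-risk over the logistic model on the ball of radius `r` and its
minimum over all measurable real functions both exist and are equal. -/
def MinRiskAttainedByModel (α : ℝ≥0∞) (P : Measure (EuclideanSpace ℝ (Fin d) × ℝ))
    (r : ℝ) : Prop :=
  ∃ m : ℝ≥0∞,
    IsLeast (modelRisk α P '' Metric.closedBall 0 r) m ∧
    IsLeast (functionRisk α P '' {f | Measurable f}) m

/-- The empirical `α`-risk at `θ` of the first `n` samples of the sequence `s`. -/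
def empiricalRisk (α : ℝ≥0∞) (n : ℕ) (s : ℕ → EuclideanSpace ℝ (Fin d) × ℝ)
    (θ : EuclideanSpace ℝ (Fin d)) : ℝ :=
  (1 / (n : ℝ)) * ∑ i ∈ Finset.range n, softLoss α (logistic θ ((s i).2 • (s i).1))

/-- The sign function with the value `s₀` at `0`. -/
def signWith (s₀ t : ℝ) : ℝ := if 0 < t then 1 else if t < 0 then -1 else s₀

/-- The `0`-`1` risk `P[Y ≠ sign(f(X))]`, where `sign(0) = s₀`. -/
def zeroOneRisk (s₀ : ℝ) (P : Measure (EuclideanSpace ℝ (Fin d) × ℝ))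
    (f : EuclideanSpace ℝ (Fin d) → ℝ) : ℝ :=
  P.real {p | p.2 ≠ signWith s₀ (f p.1)}

end AlphaLoss

end

/-!
Let `s(z) = σ(-z) σ(z)^(1-1/α)` be minus the derivative of the margin-based `α`-loss, and let `f`
be an almost surely bounded minimizer of the `α`-risk over all measurable functions. Perturbing `f`
in a bounded direction `h` gives the first-order condition `E[Y h(X) s(Y f(X))] = 0`
(`integral_marginSlope_eq_zero`). Since `s(z) / s(-z) = exp(-z/α)`, the choice `h = 1_A / s(-f)`
turns it into `P(Y = -1, X ∈ A) = E[1{Y = 1, X ∈ A} exp(-f(X)/α)]`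
(`integral_likelihoodRatio_eq_zero`): the minimizer determines the likelihood ratio of the labels.
For `α = ∞`, with `1/α = 0`, the identity says that both labels have conditional probability `1/2`.

Hence every measurable `g` has the `0`-`1` risk
`E[1{Y = 1} (1{sign g(X) = -1} + 1{sign g(X) = 1} exp(-f(X)/α))]` (`zeroOneRisk_eq_integral`).
Two consequences follow. First, `f` minimizes the `0`-`1` risk, because `exp(-f/α) ≤ 1` where
`f ≥ 0` and `exp(-f/α) ≥ 1` where `f ≤ 0` (`zeroOneRisk_le`). Second, if `g n → f` pointwise,
the `0`-`1` risks converge by dominated convergence: the sign of `g n` can fail to converge only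
where `f = 0`, and there its value does not matter (`tendsto_zeroOneRisk`).

By assumption some linear function `⟨θ₀, ·⟩` minimizes the `α`-risk. The strong law of large numbers
in the Banach space of continuous functions on the closed ball makes the empirical risk converge
uniformly to the risk, almost surely (`ae_tendsto_average_lossMap`). So every limit point `θ` of the
empirical minimizers minimizes the risk over the ball, hence over all measurable functions; by the
two consequences, the `0`-`1` risks converge to that of `⟨θ, ·⟩`, which is the minimum, along the
corresponding subsequence. Compactness of the ball gives convergence of the whole sequence.
Uniqueness of the minimizer is not needed.
-/

namespace AlphaLoss

/-! ### The slope of the margin-based loss -/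

/-- The negated derivative `σ(-z) σ(z)^(1-1/α)` of the margin-based `α`-loss. As
`(∞ : ℝ≥0∞).toReal = 0` and `1 / 0 = 0` in `ℝ`, the formula is also correct for `α = ∞`. -/
noncomputable def marginSlope (α : ℝ≥0∞) (z : ℝ) : ℝ :=
  Real.sigmoid (-z) * Real.sigmoid z ^ (1 - 1 / α.toReal)

theorem marginSlope_pos (α : ℝ≥0∞) (z : ℝ) : 0 < marginSlope α z :=
  mul_pos (Real.sigmoid_pos _) (Real.rpow_pos_of_pos (Real.sigmoid_pos _) _)

theorem continuous_marginSlope (α : ℝ≥0∞) : Continuous (marginSlope α) := by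
  unfold marginSlope
  exact (continuous_sigmoid.comp continuous_neg).mul
    (continuous_sigmoid.rpow_const fun z => Or.inl (Real.sigmoid_pos z).ne')

/-- The ratio of the slopes at opposite margins is `exp (-z / α)`. At a minimizer of the
`α`-risk it is the likelihood ratio of the labels `-1` and `1`. -/
theorem marginSlope_eq_exp_mul (α : ℝ≥0∞) (z : ℝ) :
    marginSlope α z = Real.exp (-(z / α.toReal)) * marginSlope α (-z) := by
  have h := Real.sigmoid_pos z
  unfold marginSlope
  rw [neg_neg, ← Real.sigmoid_mul_rexp_neg z, Real.mul_rpow h.le (Real.exp_pos _).le,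
    ← Real.exp_mul]
  have e : Real.exp (-z) = Real.exp (-(z / α.toReal)) * Real.exp (-z * (1 - 1 / α.toReal)) := by
    rw [← Real.exp_add]
    congr 1
    ring
  rw [e]
  ring

theorem hasDerivAt_marginLoss {α : ℝ≥0∞} (hα : 0 < α) (z : ℝ) :
    HasDerivAt (marginLoss α) (-marginSlope α z) z := by
  have hexp : HasDerivAt (fun z : ℝ => 1 + Real.exp (-z)) (-Real.exp (-z)) z := by
    simpa using ((hasDerivAt_neg z).exp).const_add 1
  have hpos : 0 < 1 + Real.exp (-z) := by positivity
  have hslope : Real.sigmoid (-z) = Real.exp (-z) * (1 + Real.exp (-z))⁻¹ := by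
    rw [← Real.sigmoid_mul_rexp_neg, Real.sigmoid_def, mul_comm]
  by_cases h1 : α = ∞
  · have hfun : marginLoss α = fun z => (1 + Real.exp z)⁻¹ := by
      funext z; simp [marginLoss, h1]
    rw [hfun]
    have hd : HasDerivAt (fun z : ℝ => 1 + Real.exp z) (Real.exp z) z :=
      (Real.hasDerivAt_exp z).const_add 1
    have h := Real.exp_pos z
    refine (hd.inv (by positivity)).congr_deriv ?_
    simp only [marginSlope, h1, ENNReal.toReal_top, div_zero, sub_zero, Real.rpow_one, hslope,
      Real.sigmoid_def, Real.exp_neg]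
    field_simp
    ring
  by_cases h2 : α = 1
  · have hfun : marginLoss α = fun z => Real.log (1 + Real.exp (-z)) := by
      funext z; simp [marginLoss, h2]
    rw [hfun]
    refine (hexp.log hpos.ne').congr_deriv ?_
    simp [marginSlope, h2, hslope, div_eq_mul_inv]
  · have hfun : marginLoss α = fun z => α.toReal / (α.toReal - 1) *
        (1 - (1 + Real.exp (-z)) ^ (1 / α.toReal - 1)) := by
      funext z; simp [marginLoss, h1, h2]
    rw [hfun]
    have ha : α.toReal ≠ 0 := (ENNReal.toReal_pos hα.ne' h1).ne'
    have ha1 : α.toReal - 1 ≠ 0 := by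
      intro h
      apply h2
      rw [← ENNReal.ofReal_toReal h1, sub_eq_zero.1 h, ENNReal.ofReal_one]
    refine (((hexp.rpow_const (p := 1 / α.toReal - 1) (Or.inl hpos.ne')).const_sub 1).const_mul
      (α.toReal / (α.toReal - 1))).congr_deriv ?_
    have hs : Real.sigmoid z ^ (1 - 1 / α.toReal) = (1 + Real.exp (-z)) ^ (1 / α.toReal - 1) := by
      rw [Real.sigmoid_def, Real.inv_rpow hpos.le, ← Real.rpow_neg hpos.le, neg_sub]
    rw [marginSlope, hs, hslope, Real.rpow_sub_one hpos.ne' (1 / α.toReal - 1)]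
    field_simp
    ring

theorem continuous_marginLoss {α : ℝ≥0∞} (hα : 0 < α) : Continuous (marginLoss α) :=
  continuous_iff_continuousAt.2 fun z => (hasDerivAt_marginLoss hα z).continuousAt

theorem exists_abs_le_on_Icc {F : ℝ → ℝ} (hF : Continuous F) (M : ℝ) :
    ∃ C, ∀ z, |z| ≤ M → |F z| ≤ C := by
  obtain ⟨C, hC⟩ := (isCompact_Icc (a := -M) (b := M)).exists_bound_of_continuousOn hF.continuousOn
  exact ⟨C, fun z hz => hC z (abs_le.1 hz)⟩

variable {d : ℕ} {P : Measure (EuclideanSpace ℝ (Fin d) × ℝ)}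

theorem modelRisk_eq_functionRisk (α : ℝ≥0∞) (P : Measure (EuclideanSpace ℝ (Fin d) × ℝ))
    (θ : EuclideanSpace ℝ (Fin d)) :
    modelRisk α P θ = functionRisk α P (fun x => inner ℝ θ x) := by
  simp only [modelRisk, functionRisk, logistic, softLoss_sigmoid, inner_smul_right]

/-! ### The first-order condition for a minimizer of the risk -/

/-- The first-order condition for a minimizer `f` of the `α`-risk, in the direction `h`. -/
theorem integral_marginSlope_eq_zero {α : ℝ≥0∞} (hα : 0 < α) (hP : IsDataLaw P)
    {f h : EuclideanSpace ℝ (Fin d) → ℝ} (hf : Measurable f) (hh : Measurable h) {M C : ℝ}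
    (hfM : ∀ᵐ p ∂P, |f p.1| ≤ M) (hhC : ∀ x, |h x| ≤ C)
    (hmin : ∀ g, Measurable g → functionRisk α P f ≤ functionRisk α P g) :
    ∫ p, p.2 * h p.1 * marginSlope α (p.2 * f p.1) ∂P = 0 := by
  have := hP.1
  have hmarg : Measurable (marginLoss α) := (continuous_marginLoss hα).measurable
  have hslope : Measurable (marginSlope α) := (continuous_marginSlope α).measurable
  have hpert : ∀ᵐ p ∂P, ∀ t ∈ Metric.ball (0 : ℝ) 1, |p.2 * (f p.1 + t * h p.1)| ≤ M + C := by
    filter_upwards [hfM, hP.2] with p hp hp2 t ht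
    have ht' : |t| ≤ 1 := by simpa using (mem_ball_zero_iff.1 ht).le
    have hy : |p.2| = 1 := by rcases hp2.2 with h | h <;> simp [h]
    rw [abs_mul, hy, one_mul]
    refine (abs_add_le _ _).trans (add_le_add hp ?_)
    rw [abs_mul]
    exact (mul_le_of_le_one_left (abs_nonneg _) ht').trans (hhC _)
  obtain ⟨A, hA⟩ := exists_abs_le_on_Icc (continuous_marginLoss hα) (M + C)
  obtain ⟨B, hB⟩ := exists_abs_le_on_Icc (continuous_marginSlope α) (M + C)
  have hmeas : ∀ t : ℝ, Measurable fun p : EuclideanSpace ℝ (Fin d) × ℝ =>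
      marginLoss α (p.2 * (f p.1 + t * h p.1)) := fun t => hmarg.comp (by fun_prop)
  have hint : ∀ t ∈ Metric.ball (0 : ℝ) 1,
      Integrable (fun p => marginLoss α (p.2 * (f p.1 + t * h p.1))) P := fun t ht =>
    Integrable.of_bound (hmeas t).aestronglyMeasurable A (by
      filter_upwards [hpert] with p hp using hA _ (hp t ht))
  have hderiv := hasDerivAt_integral_of_dominated_loc_of_deriv_le
    (F := fun t p => marginLoss α (p.2 * (f p.1 + t * h p.1)))
    (F' := fun t p => -marginSlope α (p.2 * (f p.1 + t * h p.1)) * (p.2 * h p.1))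
    (bound := fun _ => B * C) (μ := P) (x₀ := (0 : ℝ))
    (Metric.ball_mem_nhds 0 one_pos)
    (Eventually.of_forall fun t => (hmeas t).aestronglyMeasurable)
    (hint 0 (Metric.mem_ball_self one_pos))
    ((((hslope.comp (by fun_prop)).neg).mul (by fun_prop)).aestronglyMeasurable)
    (by
      filter_upwards [hpert, hP.2] with p hp hp2 t ht
      have hy : |p.2| = 1 := by rcases hp2.2 with h | h <;> simp [h]
      rw [Real.norm_eq_abs, abs_mul, abs_neg, abs_mul, hy, one_mul]
      have := hB _ (hp t ht)
      exact mul_le_mul this (hhC _) (abs_nonneg _) ((abs_nonneg _).trans this))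
    (integrable_const _)
    (Eventually.of_forall fun p t _ => by
      refine (hasDerivAt_marginLoss hα _).comp t ?_
      simpa using (((hasDerivAt_id t).mul_const (h p.1)).const_add (f p.1)).const_mul p.2)
  have hlocal : IsLocalMin (fun t => ∫ p, marginLoss α (p.2 * (f p.1 + t * h p.1)) ∂P) 0 := by
    filter_upwards [Metric.ball_mem_nhds (0 : ℝ) one_pos] with t ht
    have hrisk : ∀ t ∈ Metric.ball (0 : ℝ) 1,
        ENNReal.ofReal (∫ p, marginLoss α (p.2 * (f p.1 + t * h p.1)) ∂P) =
          functionRisk α P fun x => f x + t * h x := fun t ht =>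
      ofReal_integral_eq_lintegral_ofReal (hint t ht)
        (Eventually.of_forall fun p => marginLoss_nonneg α hα _)
    refine (ENNReal.ofReal_le_ofReal_iff
      (integral_nonneg fun p => marginLoss_nonneg α hα _)).1 ?_
    rw [hrisk t ht, hrisk 0 (Metric.mem_ball_self one_pos)]
    simpa only [zero_mul, add_zero] using hmin (fun x => f x + t * h x) (hf.add (hh.const_mul t))
  have hzero := hlocal.hasDerivAt_eq_zero hderiv.2
  simp only [zero_mul, add_zero, neg_mul, integral_neg, neg_eq_zero] at hzero
  rw [← hzero]
  exact integral_congr_ae (Eventually.of_forall fun p => mul_comm _ _)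

/-- At a minimizer `f` of the `α`-risk, `exp (-f / α)` is the likelihood ratio of the label `-1`
with respect to the label `1`: `P(Y = -1, X ∈ A) = E[1{Y = 1, X ∈ A} exp (-f X / α)]`. -/
theorem integral_likelihoodRatio_eq_zero {α : ℝ≥0∞} (hα : 0 < α) (hP : IsDataLaw P)
    {f : EuclideanSpace ℝ (Fin d) → ℝ} (hf : Measurable f) {M : ℝ}
    (hfM : ∀ᵐ p ∂P, |f p.1| ≤ M)
    (hmin : ∀ g, Measurable g → functionRisk α P f ≤ functionRisk α P g)
    {A : Set (EuclideanSpace ℝ (Fin d))} (hA : MeasurableSet A) :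
    ∫ p, A.indicator (fun x => if p.2 = 1 then Real.exp (-(f x / α.toReal)) else -1) p.1 ∂P
      = 0 := by
  have hslope : Measurable (marginSlope α) := (continuous_marginSlope α).measurable
  -- Truncating to `|f| ≤ M`, an almost sure event, makes the direction bounded.
  set h : EuclideanSpace ℝ (Fin d) → ℝ :=
    (A ∩ {x | |f x| ≤ M}).indicator fun x => (marginSlope α (-f x))⁻¹ with hdef
  have hh : Measurable h :=
    ((hslope.comp hf.neg).inv).indicator (hA.inter (measurableSet_le hf.abs measurable_const))
  obtain ⟨C, hC⟩ := exists_abs_le_on_Icc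
    ((continuous_marginSlope α).inv₀ fun z => (marginSlope_pos α z).ne') M
  have hhC : ∀ x, |h x| ≤ max C 0 := by
    intro x
    by_cases hx : x ∈ A ∩ {x | |f x| ≤ M}
    · rw [hdef, Set.indicator_of_mem hx]
      exact (hC (-f x) (by simpa using hx.2)).trans (le_max_left _ _)
    · rw [hdef, Set.indicator_of_notMem hx]
      simp
  rw [← integral_marginSlope_eq_zero hα hP hf hh hfM hhC hmin]
  refine integral_congr_ae ?_
  filter_upwards [hfM, hP.2] with p hp hp2
  by_cases hx : p.1 ∈ A
  · have hx' : p.1 ∈ A ∩ {x | |f x| ≤ M} := ⟨hx, hp⟩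
    rw [hdef, Set.indicator_of_mem hx, Set.indicator_of_mem hx']
    have hs := (marginSlope_pos α (-f p.1)).ne'
    rcases hp2.2 with hy | hy
    · norm_num [hy, hs]
    · rw [hy, if_pos rfl, one_mul, one_mul, marginSlope_eq_exp_mul α (f p.1)]
      field_simp
  · have hx' : p.1 ∉ A ∩ {x | |f x| ≤ M} := fun h => hx h.1
    rw [hdef, Set.indicator_of_notMem hx, Set.indicator_of_notMem hx']
    simp

/-! ### The zero-one risk -/

theorem measurable_signWith (s₀ : ℝ) : Measurable (signWith s₀) :=
  Measurable.ite measurableSet_Ioi measurable_const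
    (Measurable.ite measurableSet_Iio measurable_const measurable_const)

theorem signWith_eq {s₀ : ℝ} (hs₀ : s₀ = -1 ∨ s₀ = 1) (t : ℝ) :
    signWith s₀ t = -1 ∨ signWith s₀ t = 1 := by
  unfold signWith
  split_ifs <;> simp [hs₀]

theorem exp_neg_div_le {a M : ℝ} (ha : 0 ≤ a) {b : ℝ} (hb : |b| ≤ M) :
    Real.exp (-(b / a)) ≤ Real.exp (M / a) := by
  rw [Real.exp_le_exp, ← neg_div]
  exact div_le_div_of_nonneg_right ((neg_le_abs b).trans hb) ha

/-- The weight `1` on the event `Y = 1`, `sign (g X) ≠ 1` and the weight `exp (-f X / α)` on the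
event `Y = 1`, `sign (g X) = 1`, as a function of the data point `p = (X, Y)`. -/
noncomputable def labelOneRisk (α : ℝ≥0∞) (s₀ : ℝ) (f g : EuclideanSpace ℝ (Fin d) → ℝ)
    (p : EuclideanSpace ℝ (Fin d) × ℝ) : ℝ :=
  if p.2 = 1 then (if signWith s₀ (g p.1) = 1 then Real.exp (-(f p.1 / α.toReal)) else 1) else 0

theorem measurable_labelOneRisk {α : ℝ≥0∞} {s₀ : ℝ} {f g : EuclideanSpace ℝ (Fin d) → ℝ}
    (hf : Measurable f) (hg : Measurable g) : Measurable (labelOneRisk α s₀ f g) :=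
  Measurable.ite (measurable_snd (measurableSet_singleton 1))
    (Measurable.ite (((measurable_signWith s₀).comp (hg.comp measurable_fst))
      (measurableSet_singleton 1)) (by fun_prop) measurable_const) measurable_const

theorem norm_labelOneRisk_le {α : ℝ≥0∞} {s₀ : ℝ} {f g : EuclideanSpace ℝ (Fin d) → ℝ} {M : ℝ}
    {p : EuclideanSpace ℝ (Fin d) × ℝ} (hp : |f p.1| ≤ M) :
    ‖labelOneRisk α s₀ f g p‖ ≤ max (Real.exp (M / α.toReal)) 1 := by
  unfold labelOneRisk
  split_ifs
  · rw [Real.norm_eq_abs, Real.abs_exp]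
    exact (exp_neg_div_le ENNReal.toReal_nonneg hp).trans (le_max_left _ _)
  · simp
  · simp

theorem integrable_labelOneRisk [IsFiniteMeasure P] {α : ℝ≥0∞} {s₀ : ℝ}
    {f g : EuclideanSpace ℝ (Fin d) → ℝ} (hf : Measurable f) {M : ℝ}
    (hfM : ∀ᵐ p ∂P, |f p.1| ≤ M) (hg : Measurable g) :
    Integrable (labelOneRisk α s₀ f g) P :=
  Integrable.of_bound (measurable_labelOneRisk hf hg).aestronglyMeasurable _
    (hfM.mono fun _ hp => norm_labelOneRisk_le hp)

/-- The `0`-`1` risk of `g`, written as an expectation over the label `1` alone: the label `-1`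
is weighted by the likelihood ratio `exp (-f / α)` given by a minimizer `f` of the `α`-risk. -/
theorem zeroOneRisk_eq_integral {α : ℝ≥0∞} (hα : 0 < α) (hP : IsDataLaw P)
    {s₀ : ℝ} (hs₀ : s₀ = -1 ∨ s₀ = 1)
    {f : EuclideanSpace ℝ (Fin d) → ℝ} (hf : Measurable f) {M : ℝ}
    (hfM : ∀ᵐ p ∂P, |f p.1| ≤ M)
    (hmin : ∀ g, Measurable g → functionRisk α P f ≤ functionRisk α P g)
    {g : EuclideanSpace ℝ (Fin d) → ℝ} (hg : Measurable g) :
    zeroOneRisk s₀ P g = ∫ p, labelOneRisk α s₀ f g p ∂P := by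
  have := hP.1
  set A : Set (EuclideanSpace ℝ (Fin d)) := {x | signWith s₀ (g x) = 1} with hAdef
  have hA : MeasurableSet A := ((measurable_signWith s₀).comp hg) (measurableSet_singleton 1)
  set J : EuclideanSpace ℝ (Fin d) × ℝ → ℝ := fun p =>
    A.indicator (fun x => if p.2 = 1 then Real.exp (-(f x / α.toReal)) else -1) p.1 with hJ
  have hJ0 : ∫ p, J p ∂P = 0 := integral_likelihoodRatio_eq_zero hα hP hf hfM hmin hA
  have hJmeas : Measurable J := by
    have : Measurable fun p : EuclideanSpace ℝ (Fin d) × ℝ =>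
        if p.2 = 1 then Real.exp (-(f p.1 / α.toReal)) else -1 :=
      Measurable.ite (measurable_snd (measurableSet_singleton 1)) (by fun_prop) measurable_const
    exact this.indicator (measurable_fst hA)
  have hJint : Integrable J P := by
    refine Integrable.of_bound hJmeas.aestronglyMeasurable (max (Real.exp (M / α.toReal)) 1) ?_
    filter_upwards [hfM] with p hp
    refine (norm_indicator_le_norm_self _ _).trans ?_
    split_ifs
    · rw [Real.norm_eq_abs, Real.abs_exp]
      exact (exp_neg_div_le ENNReal.toReal_nonneg hp).trans (le_max_left _ _)
    · simp
  have hE : MeasurableSet {p : EuclideanSpace ℝ (Fin d) × ℝ | p.2 ≠ signWith s₀ (g p.1)} :=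
    (measurableSet_eq_fun measurable_snd
      ((measurable_signWith s₀).comp (hg.comp measurable_fst))).compl
  have hI : Integrable
      ({p : EuclideanSpace ℝ (Fin d) × ℝ | p.2 ≠ signWith s₀ (g p.1)}.indicator 1) P :=
    (integrable_const (1 : ℝ)).indicator hE
  rw [zeroOneRisk, ← integral_indicator_one hE, ← add_zero (∫ p, _ ∂P), ← hJ0,
    ← integral_add hI hJint]
  refine integral_congr_ae ?_
  filter_upwards [hP.2] with p hp
  rcases hp.2 with hy | hy <;> rcases signWith_eq hs₀ (g p.1) with hs | hs <;>
    norm_num [hJ, hAdef, labelOneRisk, Set.indicator_apply, hy, hs]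

/-- The sign of a minimizer `f` of the `α`-risk is the Bayes classifier. -/
theorem zeroOneRisk_le {α : ℝ≥0∞} (hα : 0 < α) (hP : IsDataLaw P)
    {s₀ : ℝ} (hs₀ : s₀ = -1 ∨ s₀ = 1)
    {f : EuclideanSpace ℝ (Fin d) → ℝ} (hf : Measurable f) {M : ℝ}
    (hfM : ∀ᵐ p ∂P, |f p.1| ≤ M)
    (hmin : ∀ g, Measurable g → functionRisk α P f ≤ functionRisk α P g)
    {g : EuclideanSpace ℝ (Fin d) → ℝ} (hg : Measurable g) :
    zeroOneRisk s₀ P f ≤ zeroOneRisk s₀ P g := by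
  have := hP.1
  rw [zeroOneRisk_eq_integral hα hP hs₀ hf hfM hmin hf,
    zeroOneRisk_eq_integral hα hP hs₀ hf hfM hmin hg]
  refine integral_mono (integrable_labelOneRisk hf hfM hf) (integrable_labelOneRisk hf hfM hg)
    fun p => ?_
  have ha : 0 ≤ α.toReal := ENNReal.toReal_nonneg
  have hle : 0 ≤ f p.1 → Real.exp (-(f p.1 / α.toReal)) ≤ 1 := fun h =>
    Real.exp_le_one_iff.2 (neg_nonpos.2 (div_nonneg h ha))
  have hge : f p.1 ≤ 0 → 1 ≤ Real.exp (-(f p.1 / α.toReal)) := fun h =>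
    Real.one_le_exp (neg_nonneg.2 (div_nonpos_of_nonpos_of_nonneg h ha))
  have hone : signWith s₀ (f p.1) = 1 → 0 ≤ f p.1 := by
    intro h
    by_contra! hn
    norm_num [signWith, hn, hn.le.not_gt] at h
  have hnone : signWith s₀ (f p.1) ≠ 1 → f p.1 ≤ 0 := by
    intro h
    by_contra! hn
    exact h (if_pos hn)
  simp only [labelOneRisk]
  split_ifs with h1 h2 h3 h3
  · exact le_rfl
  · exact hle (hone h2)
  · exact hge (hnone h2)
  · exact le_rfl
  · exact le_rfl

/-- If `g n → f` almost surely and `f` minimizes the `α`-risk, the `0`-`1` risk of `g n` tends to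
that of `f`. The sign of `g n` may oscillate only where `f = 0`, and there both labels have the
same conditional probability. -/
theorem tendsto_zeroOneRisk {α : ℝ≥0∞} (hα : 0 < α) (hP : IsDataLaw P)
    {s₀ : ℝ} (hs₀ : s₀ = -1 ∨ s₀ = 1)
    {f : EuclideanSpace ℝ (Fin d) → ℝ} (hf : Measurable f) {M : ℝ}
    (hfM : ∀ᵐ p ∂P, |f p.1| ≤ M)
    (hmin : ∀ g, Measurable g → functionRisk α P f ≤ functionRisk α P g)
    {g : ℕ → EuclideanSpace ℝ (Fin d) → ℝ} (hg : ∀ n, Measurable (g n))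
    (hlim : ∀ᵐ p ∂P, Tendsto (fun n => g n p.1) atTop (𝓝 (f p.1))) :
    Tendsto (fun n => zeroOneRisk s₀ P (g n)) atTop (𝓝 (zeroOneRisk s₀ P f)) := by
  have := hP.1
  simp only [zeroOneRisk_eq_integral hα hP hs₀ hf hfM hmin hf,
    fun n => zeroOneRisk_eq_integral hα hP hs₀ hf hfM hmin (hg n)]
  refine tendsto_integral_of_dominated_convergence (fun _ => max (Real.exp (M / α.toReal)) 1)
    (fun n => (measurable_labelOneRisk hf (hg n)).aestronglyMeasurable) (integrable_const _)
    (fun n => hfM.mono fun p hp => norm_labelOneRisk_le hp) ?_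
  filter_upwards [hlim] with p hp
  apply tendsto_const_nhds.congr'
  rcases lt_trichotomy (f p.1) 0 with h | h | h
  · filter_upwards [hp.eventually_lt_const h] with n hn
    simp [labelOneRisk, signWith, h, hn, h.le.not_gt, hn.le.not_gt]
  · exact Eventually.of_forall fun n => by simp [labelOneRisk, h]
  · filter_upwards [hp.eventually_const_lt h] with n hn
    simp [labelOneRisk, signWith, h, hn]

/-! ### The uniform law of large numbers -/

/-- The loss at the data point `p`, as a continuous function of the parameter `θ` in the closed
ball of radius `r`, depending continuously on `p`. -/
noncomputable def lossMap {α : ℝ≥0∞} (hα : 0 < α) (d : ℕ) (r : ℝ) :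
    C(EuclideanSpace ℝ (Fin d) × ℝ,
      C(Metric.closedBall (0 : EuclideanSpace ℝ (Fin d)) r, ℝ)) :=
  ContinuousMap.curry ⟨fun q => marginLoss α (q.1.2 * inner ℝ q.2.1 q.1.1),
    (continuous_marginLoss hα).comp (by fun_prop)⟩

theorem lossMap_apply {α : ℝ≥0∞} (hα : 0 < α) {r : ℝ} (p : EuclideanSpace ℝ (Fin d) × ℝ)
    (θ : Metric.closedBall (0 : EuclideanSpace ℝ (Fin d)) r) :
    lossMap hα d r p θ = marginLoss α (p.2 * inner ℝ θ.1 p.1) := rfl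

theorem empiricalRisk_eq {α : ℝ≥0∞} (hα : 0 < α) {r : ℝ} (n : ℕ)
    (s : ℕ → EuclideanSpace ℝ (Fin d) × ℝ)
    (θ : Metric.closedBall (0 : EuclideanSpace ℝ (Fin d)) r) :
    empiricalRisk α n s θ = ((n : ℝ)⁻¹ • ∑ i ∈ Finset.range n, lossMap hα d r (s i)) θ := by
  simp [empiricalRisk, logistic, softLoss_sigmoid, inner_smul_right, lossMap_apply]

theorem isCompact_cube (d : ℕ) :
    IsCompact {x : EuclideanSpace ℝ (Fin d) | ∀ j, x j ∈ Set.Icc (0 : ℝ) 1} := by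
  have h := (EuclideanSpace.equiv (Fin d) ℝ).toHomeomorph.isCompact_preimage.2
    (isCompact_univ_pi fun _ : Fin d => isCompact_Icc (a := (0 : ℝ)) (b := 1))
  convert h using 1
  ext x
  simp only [Set.mem_preimage, Set.mem_univ_pi]
  rfl

theorem IsDataLaw.exists_norm_le {F : Type*} [NormedAddCommGroup F] (hP : IsDataLaw P)
    {φ : EuclideanSpace ℝ (Fin d) × ℝ → F} (hφ : Continuous φ) :
    ∃ C, ∀ᵐ p ∂P, ‖φ p‖ ≤ C := by
  have hK := (isCompact_cube d).prod (Set.toFinite {(-1 : ℝ), 1}).isCompact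
  obtain ⟨C, hC⟩ := hK.exists_bound_of_continuousOn hφ.continuousOn
  exact ⟨C, hP.2.mono fun p hp => hC p ⟨hp.1, by simpa using hp.2⟩⟩

theorem IsDataLaw.integrable {F : Type*} [NormedAddCommGroup F] (hP : IsDataLaw P)
    {φ : EuclideanSpace ℝ (Fin d) × ℝ → F} (hφ : Continuous φ) : Integrable φ P := by
  have := hP.1
  obtain ⟨C, hC⟩ := hP.exists_norm_le hφ
  exact Integrable.of_bound hφ.aestronglyMeasurable C hC

theorem modelRisk_eq_ofReal {α : ℝ≥0∞} (hα : 0 < α) (hP : IsDataLaw P) {r : ℝ}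
    (θ : Metric.closedBall (0 : EuclideanSpace ℝ (Fin d)) r) :
    modelRisk α P θ = ENNReal.ofReal ((∫ p, lossMap hα d r p ∂P) θ) := by
  have hint := hP.integrable (lossMap hα d r).continuous
  have heval := (ContinuousMap.evalCLM ℝ θ).integral_comp_comm hint
  have hint' := (ContinuousMap.evalCLM ℝ θ).integrable_comp hint
  rw [modelRisk_eq_functionRisk, functionRisk]
  change _ = ENNReal.ofReal (ContinuousMap.evalCLM ℝ θ _)
  rw [← heval]
  exact (ofReal_integral_eq_lintegral_ofReal hint'
    (Eventually.of_forall fun p => marginLoss_nonneg α hα _)).symm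

/-- The law of large numbers, uniformly over the ball of parameters: it holds in the Banach space
of continuous functions on the ball. -/
theorem ae_tendsto_average_lossMap {α : ℝ≥0∞} (hα : 0 < α) (hP : IsDataLaw P) (r : ℝ)
    {Ω : Type*} [MeasurableSpace Ω] (μ : Measure Ω)
    (S : ℕ → Ω → EuclideanSpace ℝ (Fin d) × ℝ)
    (hindep : iIndepFun S μ) (hlaw : ∀ i, HasLaw (S i) P μ) :
    ∀ᵐ ω ∂μ, Tendsto
      (fun n : ℕ => (n : ℝ)⁻¹ • ∑ i ∈ Finset.range n, lossMap hα d r (S i ω))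
      atTop (𝓝 (∫ p, lossMap hα d r p ∂P)) := by
  let _ : MeasurableSpace C(Metric.closedBall (0 : EuclideanSpace ℝ (Fin d)) r, ℝ) := borel _
  have : BorelSpace C(Metric.closedBall (0 : EuclideanSpace ℝ (Fin d)) r, ℝ) := ⟨rfl⟩
  have hcont := (lossMap hα d r).continuous
  have hint := hP.integrable hcont
  have hX : Integrable (lossMap hα d r ∘ S 0) μ := by
    rw [← (hlaw 0).map_eq] at hint
    exact hint.comp_aemeasurable (hlaw 0).aemeasurable
  have h := strong_law_ae (μ := μ) (fun i => lossMap hα d r ∘ S i) hX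
    (fun i j hij => (hindep.indepFun hij).comp hcont.measurable hcont.measurable)
    (fun i => ((hlaw i).identDistrib (hlaw 0)).comp hcont.measurable)
  rwa [(hlaw 0).integral_comp hint.aestronglyMeasurable] at h

end AlphaLoss

/-! ### Convergence of the zero-one risk of the empirical minimizers -/

theorem mainTheorem2 (d : ℕ) (r : ℝ) (hr : 0 < r) (α : ℝ≥0∞) (hα : 0 < α)
    (s₀ : ℝ) (hs₀ : s₀ = -1 ∨ s₀ = 1)
    (P : Measure (EuclideanSpace ℝ (Fin d) × ℝ)) (hP : AlphaLoss.IsDataLaw P)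
    (hmin : AlphaLoss.MinRiskAttainedByModel α P r)
    {Ω : Type*} [MeasurableSpace Ω] (μ : Measure Ω) [IsProbabilityMeasure μ]
    (S : ℕ → Ω → EuclideanSpace ℝ (Fin d) × ℝ)
    (hindep : iIndepFun S μ) (hlaw : ∀ i, HasLaw (S i) P μ)
    (θhat : ℕ → Ω → EuclideanSpace ℝ (Fin d))
    (hθhat : ∀ᵐ ω ∂μ, ∀ n : ℕ, 1 ≤ n →
      θhat n ω ∈ Metric.closedBall 0 r ∧
      IsMinOn (AlphaLoss.empiricalRisk α n (fun i => S i ω)) (Metric.closedBall 0 r)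
        (θhat n ω)) :
    ∃ Rstar : ℝ,
      IsLeast (AlphaLoss.zeroOneRisk s₀ P '' {f | Measurable f}) Rstar ∧
      ∀ᵐ ω ∂μ, Tendsto
        (fun n => AlphaLoss.zeroOneRisk s₀ P (fun x => inner ℝ (θhat n ω) x))
        atTop (𝓝 Rstar) := by
  obtain ⟨m, ⟨⟨θ₀, hθ₀, hm₀⟩, -⟩, -, hmf⟩ := hmin
  have hmeas : ∀ θ : EuclideanSpace ℝ (Fin d),
      Measurable fun x : EuclideanSpace ℝ (Fin d) => (inner ℝ θ x : ℝ) := fun θ => by fun_prop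
  have hbound : ∀ θ : EuclideanSpace ℝ (Fin d), ∃ M, ∀ᵐ p ∂P, |(inner ℝ θ p.1 : ℝ)| ≤ M :=
    fun θ => hP.exists_norm_le (φ := fun p => (inner ℝ θ p.1 : ℝ)) (by fun_prop)
  have hmin' : ∀ θ, AlphaLoss.modelRisk α P θ ≤ m → ∀ g, Measurable g →
      AlphaLoss.functionRisk α P (fun x => inner ℝ θ x) ≤ AlphaLoss.functionRisk α P g :=
    fun θ hθ g hg => by
      rw [← AlphaLoss.modelRisk_eq_functionRisk]
      exact hθ.trans (hmf ⟨g, hg, rfl⟩)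
  obtain ⟨M₀, hM₀⟩ := hbound θ₀
  have hbayes : ∀ g, Measurable g → AlphaLoss.zeroOneRisk s₀ P (fun x => inner ℝ θ₀ x) ≤
      AlphaLoss.zeroOneRisk s₀ P g := fun g hg =>
    AlphaLoss.zeroOneRisk_le hα hP hs₀ (hmeas θ₀) hM₀ (hmin' θ₀ hm₀.le) hg
  refine ⟨AlphaLoss.zeroOneRisk s₀ P (fun x => inner ℝ θ₀ x), ⟨⟨_, hmeas θ₀, rfl⟩, ?_⟩, ?_⟩
  · rintro _ ⟨g, hg, rfl⟩
    exact hbayes g hg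
  filter_upwards [hθhat, AlphaLoss.ae_tendsto_average_lossMap hα hP r μ S hindep hlaw]
    with ω hω hlln
  refine tendsto_of_subseq_tendsto fun ns hns => ?_
  -- The empirical minimizers are only controlled for positive sample sizes.
  obtain ⟨N, hN⟩ := eventually_atTop.1 (hns.eventually_ge_atTop 1)
  let u : ℕ → Metric.closedBall (0 : EuclideanSpace ℝ (Fin d)) r := fun k =>
    ⟨θhat (ns (k + N)) ω, (hω _ (hN _ (Nat.le_add_left N k))).1⟩
  obtain ⟨θ, φ, hφ, hlim⟩ := CompactSpace.tendsto_subseq u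
  have hnsφ : Tendsto (fun k => ns (φ k + N)) atTop atTop :=
    hns.comp ((tendsto_add_atTop_nat N).comp hφ.tendsto_atTop)
  refine ⟨fun k => φ k + N, ?_⟩
  -- Empirical minimality passes to the limit, uniformly in the parameter.
  have hle : (∫ p, AlphaLoss.lossMap hα d r p ∂P) θ ≤
      (∫ p, AlphaLoss.lossMap hα d r p ∂P) ⟨θ₀, hθ₀⟩ := by
    have hl := hlln.comp hnsφ
    refine le_of_tendsto_of_tendsto' (hl.eval hlim) (hl.eval tendsto_const_nhds) fun k => ?_
    have h := (hω _ (hN _ (Nat.le_add_left N (φ k)))).2 hθ₀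
    have e₁ := AlphaLoss.empiricalRisk_eq hα (ns (φ k + N)) (fun i => S i ω) (u (φ k))
    have e₂ := AlphaLoss.empiricalRisk_eq hα (ns (φ k + N)) (fun i => S i ω) ⟨θ₀, hθ₀⟩
    exact (e₁.symm.trans_le h).trans_eq e₂
  have hθm : AlphaLoss.modelRisk α P θ ≤ m := by
    rw [← hm₀, AlphaLoss.modelRisk_eq_ofReal hα hP θ,
      AlphaLoss.modelRisk_eq_ofReal hα hP ⟨θ₀, hθ₀⟩]
    exact ENNReal.ofReal_le_ofReal hle
  obtain ⟨M, hM⟩ := hbound θ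
  have heq : AlphaLoss.zeroOneRisk s₀ P (fun x => inner ℝ θ₀ x) =
      AlphaLoss.zeroOneRisk s₀ P (fun x => inner ℝ θ.1 x) :=
    le_antisymm (hbayes _ (hmeas θ))
      (AlphaLoss.zeroOneRisk_le hα hP hs₀ (hmeas θ) hM (hmin' θ hθm) (hmeas θ₀))
  rw [heq]
  refine AlphaLoss.tendsto_zeroOneRisk hα hP hs₀ (hmeas θ) hM (hmin' θ hθm)
    (fun k => hmeas _) (Eventually.of_forall fun p => ?_)
  exact ((continuous_subtype_val.tendsto θ).comp hlim).inner tendsto_const_nhds
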